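/- **Theorem 3.2.** Let $R$ be a commutative ring with identity and let $A$ be a cellular $R$-algebra in the sense of Graham and Lehrer with cell datum $(\Lambda,M,C,i)$: $\Lambda$ is a finite poset; each $M(\lambda)$, $\lambda\in\Lambda$, is a finite set; the elements $C^\lambda_{S,T}$ ($\lambda\in\Lambda$, $S,T\in M(\lambda)$) form an $R$-basis of $A$; $i$ is an $R$-linear anti-automorphism of $A$ with $i^2=\mathrm{id}$ and $i(C^\lambda_{S,T})=C^\lambda_{T,S}$; and for all $a\in A$, $\lambda\in\Lambda$ there are $r_a(S',S)\in R$ such that for all $S,T\in M(\lambda)$ $$aC^\lambda_{S,T}\equiv\sum_{S'\in M(\lambda)}r_a(S',S)\,C^\lambda_{S',T}\pmod{A(<\lambda)},$$ where $A(<\lambda)$ is the $R$-span of all $C^\mu_{U,V}$ with $\mu<\lambda$. Let $\tau:A\to R$ be a symmetrizing trace, that is, $\tau(a)=f(a,1)$ for some symmetric $R$-bilinear form $f$ on $A$ that is associative ($f(ab,c)=f(a,bc)$) and non-degenerate (its Gram determinant with respect to some $R$-basis of $A$ is a unit of $R$). Let $\{D^\lambda_{S,T}\}$ be the basis of $A$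 dual to $\{C^\lambda_{S,T}\}$ with respect to $\tau$, that is, $\tau(D^\mu_{U,V}C^\lambda_{S,T})=1$ if $(\lambda,S,T)=(\mu,U,V)$ and $0$ otherwise. For $\lambda\in\Lambda$ and $T\in M(\lambda)$ put $$x_\lambda=\sum_{S\in M(\lambda)}C^\lambda_{S,T}D^\lambda_{S,T},$$ let $L(A)$ be the $R$-span of these elements (over all $\lambda$ with $M(\lambda)\neq\emptyset$), and let $H(A)=\bigl\{\sum_{\lambda\in\Lambda,\,S,T\in M(\lambda)}C^\lambda_{S,T}\,a\,D^\lambda_{S,T} : a\in A\bigr\}$ be the Higman ideal. Then $x_\lambda$ does not depend on the choice of $T\in M(\lambda)$, and: 1. $L(A)$ is an ideal of the center $Z(A)$ and contains $H(A)$. 2. $L(A)$ does not depend on the choice of the symmetrizing trace $\tau$. 3. If $R$ is a field, then the number of isomorphism classes of simple left $A$-modules is finite and at most $\dim_R L(A)$. -/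

import Mathlib

universe u v w

namespace SymmCellular

section Symmetric

variable {R : Type*} {A : Type*} [CommRing R] [Ring A] [Algebra R A]

/-- A bilinear form on `A` is non-degenerate over `R` if its Gram determinant with respect to some
finite `R`-basis of `A` is a unit of `R`. -/
def IsUnimodular (f : LinearMap.BilinForm R A) : Prop :=
  ∃ (n : ℕ) (b : Module.Basis (Fin n) R A),
    IsUnit (Matrix.det (Matrix.of fun i j => f (b i) (b j)))

/-- `τ` is a symmetrizing trace on `A`: it is of the form `τ a = f (a, 1)` for some non-degenerate
associative symmetric bilinear form `f` on `A`. (`A` is a symmetric algebra iff such a `τ` exists.) -/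
def IsSymmetrizingTrace (τ : A →ₗ[R] R) : Prop :=
  ∃ f : LinearMap.BilinForm R A,
    IsUnimodular f ∧ (∀ a b c : A, f (a * b) c = f a (b * c)) ∧ (∀ a b : A, f a b = f b a) ∧
      ∀ a : A, τ a = f a 1

/-- The map `A → Hom_R(A, R)`, `a ↦ (x ↦ τ (a * x))`. -/
def traceMap (τ : A →ₗ[R] R) : A →ₗ[R] Module.Dual R A :=
  (LinearMap.mul R A).compr₂ τ

theorem traceMap_apply (τ : A →ₗ[R] R) (a x : A) : traceMap τ a x = τ (a * x) := rfl

theorem IsSymmetrizingTrace.bijective {τ : A →ₗ[R] R} (hτ : IsSymmetrizingTrace τ) :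
    Function.Bijective (traceMap τ) := by
  obtain ⟨f, ⟨n, b, hdet⟩, hassoc, hsymm, hf⟩ := hτ
  have hdet' : IsUnit (LinearMap.toMatrix b b.dualBasis (traceMap τ)).det := by
    convert hdet using 2
    ext i j
    rw [LinearMap.toMatrix_apply, Module.Basis.dualBasis_repr, traceMap_apply, hf, hassoc, mul_one,
      hsymm, Matrix.of_apply]
  exact (LinearEquiv.ofIsUnitDet hdet').bijective

open Classical in
/-- The basis `D` of `A` dual to the basis `b` with respect to the symmetrizing trace `τ`, i.e. the
basis determined by `τ (D j * b i) = δ_{ij}`; see `trace_dualBasis_mul`. -/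
noncomputable def dualBasis {ι : Type*} [Fintype ι] (b : Module.Basis ι R A) (τ : A →ₗ[R] R)
    (hτ : IsSymmetrizingTrace τ) : Module.Basis ι R A :=
  b.dualBasis.map (LinearEquiv.ofBijective (traceMap τ) hτ.bijective).symm

open Classical in
theorem trace_dualBasis_mul {ι : Type*} [Fintype ι] (b : Module.Basis ι R A) (τ : A →ₗ[R] R)
    (hτ : IsSymmetrizingTrace τ) (i j : ι) :
    τ (dualBasis b τ hτ j * b i) = if i = j then 1 else 0 := by
  rw [← traceMap_apply, dualBasis, Module.Basis.map_apply,
    ← LinearEquiv.ofBijective_apply (traceMap τ) (hf := hτ.bijective),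
    LinearEquiv.apply_symm_apply]
  simp [Finsupp.single_apply]

end Symmetric

section Cellular

/-- For a basis `C^λ_{S,T}` of `A`, the submodule `A(< l)`: the span of the basis elements
`C^μ_{S,T}` with `μ < l`. -/
def lowerSpan {R : Type*} {A : Type*} [CommRing R] [Ring A] [Algebra R A]
    {Λ : Type*} [PartialOrder Λ] {M : Λ → Type*}
    (C : Module.Basis (Σ l : Λ, M l × M l) R A) (l : Λ) : Submodule R A :=
  Submodule.span R {x | ∃ (m : Λ) (S T : M m), m < l ∧ x = C ⟨m, S, T⟩}

/-- A cell datum `(Λ, M, C, i)` for the `R`-algebra `A`, in the sense of Graham and Lehrer. -/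
structure CellDatum (R : Type*) (A : Type*) [CommRing R] [Ring A] [Algebra R A]
    (Λ : Type*) [PartialOrder Λ] [Fintype Λ] (M : Λ → Type*) [∀ l, Fintype (M l)] where
  /-- The cellular basis; `C ⟨l, S, T⟩` is `C^l_{S,T}`. -/
  C : Module.Basis (Σ l : Λ, M l × M l) R A
  /-- The `R`-linear anti-involution. -/
  i : A →ₗ[R] A
  i_mul : ∀ a b : A, i (a * b) = i b * i a
  i_i : ∀ a : A, i (i a) = a
  i_C : ∀ (l : Λ) (S T : M l), i (C ⟨l, S, T⟩) = C ⟨l, T, S⟩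
  /-- Left multiplication by `a`, modulo `A(< l)`, has coefficients not depending on `T`. -/
  mul_C : ∀ (l : Λ) (a : A), ∃ r : M l → M l → R, ∀ S T : M l,
    a * C ⟨l, S, T⟩ - ∑ S' : M l, r S' S • C ⟨l, S', T⟩ ∈ lowerSpan C l

variable {R : Type*} {A : Type*} [CommRing R] [Ring A] [Algebra R A]
  {Λ : Type*} [PartialOrder Λ] [Fintype Λ] {M : Λ → Type*} [∀ l, Fintype (M l)]

namespace CellDatum

/-- The basis `D^λ_{S,T}` dual to the cellular basis with respect to `τ`. -/
noncomputable def D (c : CellDatum R A Λ M) (τ : A →ₗ[R] R) (hτ : IsSymmetrizingTrace τ) :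
    Module.Basis (Σ l : Λ, M l × M l) R A :=
  dualBasis c.C τ hτ

/-- The element `x_l = ∑_S C^l_{S,T} D^l_{S,T}`, formed with the given `T ∈ M(l)`. -/
noncomputable def x (c : CellDatum R A Λ M) (τ : A →ₗ[R] R) (hτ : IsSymmetrizingTrace τ)
    (l : Λ) (T : M l) : A :=
  ∑ S : M l, c.C ⟨l, S, T⟩ * c.D τ hτ ⟨l, S, T⟩

/-- `L(A)`: the `R`-span of the elements `x_l`. -/
noncomputable def L (c : CellDatum R A Λ M) (τ : A →ₗ[R] R) (hτ : IsSymmetrizingTrace τ) :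
    Submodule R A :=
  Submodule.span R {y | ∃ (l : Λ) (T : M l), y = c.x τ hτ l T}

/-- The Higman ideal `H(A)`: all elements `∑ C^l_{S,T} a D^l_{S,T}` with `a ∈ A`. -/
def higman (c : CellDatum R A Λ M) (τ : A →ₗ[R] R) (hτ : IsSymmetrizingTrace τ) : Set A :=
  {y | ∃ a : A, y = ∑ p : (Σ l : Λ, M l × M l), c.C p * a * c.D τ hτ p}

end CellDatum

end Cellular

/-- Isomorphism of simple left `A`-modules. -/
def simpleModuleSetoid (A : Type v) [Ring A] :
    Setoid {V : ModuleCat.{w} A // IsSimpleModule A V} where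
  r V W := Nonempty (V.1 ≃ₗ[A] W.1)
  iseqv := ⟨fun V => ⟨LinearEquiv.refl A V.1⟩, fun ⟨e⟩ => ⟨e.symm⟩, fun ⟨e⟩ ⟨e'⟩ => ⟨e.trans e'⟩⟩

/-- The isomorphism classes of simple left `A`-modules (with carrier in `Type w`). -/
def SimpleModuleClasses (A : Type v) [Ring A] : Type (max v (w + 1)) :=
  Quotient (simpleModuleSetoid.{v, w} A)

end SymmCellular

/-!
The element `x_l` represents the character of the cell module of `l` with respect to `τ`: if
`r_l(y)` is the matrix by which `y` acts on the cell module, then `τ (x_l * y) = tr r_l(y)`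
(`CellDatum.trace_x_mul`), because `τ (D_p * y * C_p)` is the coefficient of `C_p` in `y * C_p`.
As `τ` is non-degenerate, `x_l` is determined by this character, so it does not depend on `T`, and it
is central because a matrix trace is symmetric.

A central element `z` acts on every cell module by a scalar: left multiplication by `z` changes only
the first index of `C_{S,T}`, right multiplication only the second (`CellDatum.act_central`). Hence
`z * x_l` is a multiple of `x_l`, which gives the ideal property. It also gives the independence of
the trace, since two symmetrizing traces differ by a central factor `u`, and then `x_l = u * x'_l`.
The element `∑ C_p a D_p` of the Higman ideal represents the trace of `b ↦ y * b * a` on `A`. Along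
the cell filtration this trace is `∑_l χ_l(y) χ_l(i a)`, so the element is a combination of the `x_l`.

Over a field, let `φ_l` be the bilinear form given by `C_{S,T} C_{U,V} ≡ φ_l(T,U) C_{S,V}`. The
`x_l` with `φ_l ≠ 0` are linearly independent: if `φ_l(T,U) ≠ 0`, then `χ_m (C^l_{U,T})` vanishes
unless `m ≤ l` and equals `φ_l(T,U)` for `m = l`. A simple module `V` lives in the cell of a minimal `l`
with `C^l` not annihilating `V`, and there `φ_l ≠ 0`. With `φ_l(T,U) ≠ 0`, the element
`e = C^l_{U,T}` satisfies `e a e ≡ k(a) e`, and for `e v ≠ 0` the annihilator of `e v` is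
`{a | ∀ b, k(b a) = 0}`. This depends on `l` only, so `l` determines `V` up to isomorphism.
-/

namespace SymmCellular

/-! ### Symmetrizing traces -/

section Trace

variable {R A : Type*} [CommRing R] [Ring A] [Algebra R A]

theorem IsSymmetrizingTrace.mul_comm {τ : A →ₗ[R] R} (hτ : IsSymmetrizingTrace τ) (a b : A) :
    τ (a * b) = τ (b * a) := by
  obtain ⟨f, -, hassoc, hsymm, hf⟩ := hτ
  rw [hf, hf, hassoc, hassoc, mul_one, mul_one, hsymm]

theorem IsSymmetrizingTrace.ext {τ : A →ₗ[R] R} (hτ : IsSymmetrizingTrace τ) {a b : A}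
    (h : ∀ y, τ (a * y) = τ (b * y)) : a = b :=
  hτ.bijective.1 (LinearMap.ext h)

/-- Pairing with the dual basis reads off coordinates. -/
theorem trace_dualBasis_mul_eq_repr {ι : Type*} [Fintype ι] (b : Module.Basis ι R A)
    (τ : A →ₗ[R] R) (hτ : IsSymmetrizingTrace τ) (j : ι) (a : A) :
    τ (dualBasis b τ hτ j * a) = b.repr a j := by
  classical
  conv_lhs => rw [← b.sum_repr a, Finset.mul_sum, map_sum]
  simp only [mul_smul_comm, map_smul, trace_dualBasis_mul, smul_eq_mul]
  simp

/-- Two symmetrizing traces differ by a central factor. -/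
theorem IsSymmetrizingTrace.exists_central {τ τ' : A →ₗ[R] R} (hτ : IsSymmetrizingTrace τ)
    (hτ' : IsSymmetrizingTrace τ') :
    ∃ u : A, (∀ a, u * a = a * u) ∧ ∀ a, τ' a = τ (u * a) := by
  obtain ⟨u, hu⟩ := hτ.bijective.2 τ'
  have hu' : ∀ a, τ' a = τ (u * a) := fun a => by rw [← hu, traceMap_apply]
  refine ⟨u, fun a => hτ.ext fun y => ?_, hu'⟩
  rw [mul_assoc, ← hu', hτ'.mul_comm, hu', ← mul_assoc, hτ.mul_comm, ← mul_assoc]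

end Trace

namespace CellDatum

variable {R A : Type*} [CommRing R] [Ring A] [Algebra R A]
  {Λ : Type*} [PartialOrder Λ] [Fintype Λ] {M : Λ → Type*} [∀ l, Fintype (M l)]
  (c : CellDatum R A Λ M)

/-! ### The cell filtration -/

theorem C_mem_lowerSpan {l m : Λ} (h : m < l) (S T : M m) : c.C ⟨m, S, T⟩ ∈ lowerSpan c.C l :=
  Submodule.subset_span ⟨m, S, T, h, rfl⟩

theorem lowerSpan_mono {l m : Λ} (h : m ≤ l) : lowerSpan c.C m ≤ lowerSpan c.C l := by
  refine Submodule.span_mono ?_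
  rintro _ ⟨k, S, T, hk, rfl⟩
  exact ⟨k, S, T, hk.trans_le h, rfl⟩

theorem repr_eq_zero_of_mem_lowerSpan {l : Λ} {z : A} (hz : z ∈ lowerSpan c.C l)
    (p : Σ l : Λ, M l × M l) (hp : ¬ p.1 < l) : c.C.repr z p = 0 := by
  classical
  induction hz using Submodule.span_induction with
  | mem x hx =>
    obtain ⟨m, S, T, hm, rfl⟩ := hx
    rw [c.C.repr_self, Finsupp.single_apply, if_neg]
    rintro rfl
    exact hp hm
  | zero => simp
  | add x y _ _ hx hy => simp [hx, hy]
  | smul r x _ hx => simp [hx]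

theorem mul_mem_lowerSpan {l : Λ} (a : A) {z : A} (hz : z ∈ lowerSpan c.C l) :
    a * z ∈ lowerSpan c.C l := by
  induction hz using Submodule.span_induction with
  | mem x hx =>
    obtain ⟨m, S, T, hm, rfl⟩ := hx
    obtain ⟨r, hr⟩ := c.mul_C m a
    rw [← sub_add_cancel (a * c.C ⟨m, S, T⟩) (∑ S' : M m, r S' S • c.C ⟨m, S', T⟩)]
    exact add_mem (c.lowerSpan_mono hm.le (hr S T))
      (sum_mem fun S' _ => Submodule.smul_mem _ _ (c.C_mem_lowerSpan hm S' T))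
  | zero => simp
  | add x y _ _ hx hy => rw [mul_add]; exact add_mem hx hy
  | smul r x _ hx => rw [mul_smul_comm]; exact Submodule.smul_mem _ _ hx

theorem i_mem_lowerSpan {l : Λ} {z : A} (hz : z ∈ lowerSpan c.C l) :
    c.i z ∈ lowerSpan c.C l := by
  induction hz using Submodule.span_induction with
  | mem x hx =>
    obtain ⟨m, S, T, hm, rfl⟩ := hx
    rw [c.i_C]
    exact c.C_mem_lowerSpan hm T S
  | zero => simp
  | add x y _ _ hx hy => rw [map_add]; exact add_mem hx hy
  | smul r x _ hx => rw [map_smul]; exact Submodule.smul_mem _ _ hx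

theorem mem_lowerSpan_mul {l : Λ} (a : A) {z : A} (hz : z ∈ lowerSpan c.C l) :
    z * a ∈ lowerSpan c.C l := by
  have h := c.i_mem_lowerSpan (c.mul_mem_lowerSpan (c.i a) (c.i_mem_lowerSpan hz))
  rwa [c.i_mul, c.i_i, c.i_i] at h

/-! ### The action on the cell modules -/

/-- The matrix `r_a(S', S)` by which `a` acts on the cell module of `l`. It is uniquely determined,
as soon as `M l` is nonempty. -/
noncomputable def act (l : Λ) (a : A) : Matrix (M l) (M l) R :=
  Classical.choose (c.mul_C l a)

/-- The character of the cell module of `l`. -/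
noncomputable def cellChar (l : Λ) (a : A) : R :=
  (c.act l a).trace

theorem mul_C_sub_mem (l : Λ) (a : A) (S T : M l) :
    a * c.C ⟨l, S, T⟩ - ∑ S' : M l, c.act l a S' S • c.C ⟨l, S', T⟩ ∈ lowerSpan c.C l :=
  Classical.choose_spec (c.mul_C l a) S T

theorem C_mul_sub_mem (l : Λ) (a : A) (S T : M l) :
    c.C ⟨l, S, T⟩ * a - ∑ T' : M l, c.act l (c.i a) T' T • c.C ⟨l, S, T'⟩ ∈ lowerSpan c.C l := by
  have h := c.i_mem_lowerSpan (c.mul_C_sub_mem l (c.i a) T S)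
  simpa [c.i_mul, c.i_i, c.i_C] using h

theorem repr_eq_of_sub_mem {l : Λ} {y z : A} (h : y - z ∈ lowerSpan c.C l) (S T : M l) :
    c.C.repr y ⟨l, S, T⟩ = c.C.repr z ⟨l, S, T⟩ := by
  have := c.repr_eq_zero_of_mem_lowerSpan h ⟨l, S, T⟩ (lt_irrefl l)
  rwa [map_sub, Finsupp.sub_apply, sub_eq_zero] at this

open Classical in
theorem repr_C (l : Λ) (S T S' T' : M l) :
    c.C.repr (c.C ⟨l, S, T⟩) ⟨l, S', T'⟩ = if S = S' ∧ T = T' then 1 else 0 := by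
  rw [c.C.repr_self, Finsupp.single_apply]
  simp

open Classical in
theorem repr_mul_C (l : Λ) (a : A) (S T S' T' : M l) :
    c.C.repr (a * c.C ⟨l, S, T⟩) ⟨l, S', T'⟩ = if T = T' then c.act l a S' S else 0 := by
  rw [c.repr_eq_of_sub_mem (c.mul_C_sub_mem l a S T)]
  simp only [map_sum, map_smul, Finsupp.finsetSum_apply, Finsupp.smul_apply, repr_C]
  by_cases h : T = T' <;> simp [h]

open Classical in
theorem repr_C_mul (l : Λ) (a : A) (S T S' T' : M l) :
    c.C.repr (c.C ⟨l, S, T⟩ * a) ⟨l, S', T'⟩ = if S = S' then c.act l (c.i a) T' T else 0 := by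
  rw [c.repr_eq_of_sub_mem (c.C_mul_sub_mem l a S T)]
  simp only [map_sum, map_smul, Finsupp.finsetSum_apply, Finsupp.smul_apply, repr_C]
  by_cases h : S = S' <;> simp [h]

theorem repr_mul_C_mul (l : Λ) (y a : A) (S T : M l) :
    c.C.repr (y * c.C ⟨l, S, T⟩ * a) ⟨l, S, T⟩ = c.act l y S S * c.act l (c.i a) T T := by
  classical
  have h := c.mem_lowerSpan_mul a (c.mul_C_sub_mem l y S T)
  rw [sub_mul] at h
  rw [c.repr_eq_of_sub_mem h, Finset.sum_mul]
  simp [Finsupp.finsetSum_apply, repr_C_mul]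

theorem act_mul (l : Λ) (a b : A) : c.act l (a * b) = c.act l a * c.act l b := by
  classical
  ext S' S
  have h := c.mul_mem_lowerSpan a (c.mul_C_sub_mem l b S S)
  rw [mul_sub] at h
  have h1 := c.repr_eq_of_sub_mem h S' S
  rw [← mul_assoc, repr_mul_C, if_pos rfl] at h1
  rw [h1, Finset.mul_sum, Matrix.mul_apply]
  simp [Finsupp.finsetSum_apply, repr_mul_C, mul_comm]

theorem cellChar_mul_comm (l : Λ) (a b : A) : c.cellChar l (a * b) = c.cellChar l (b * a) := by
  rw [cellChar, cellChar, act_mul, act_mul, Matrix.trace_mul_comm]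

open Classical in
/-- A central element acts on a cell module by a scalar: comparing left and right multiplication on
`C_{S,T}`, the diagonal entry at `S` equals a number that depends on `T` only. -/
theorem act_central (l : Λ) {z : A} (hz : ∀ a, z * a = a * z) :
    ∃ s : R, c.act l z = s • (1 : Matrix (M l) (M l) R) := by
  rcases isEmpty_or_nonempty (M l) with h | ⟨⟨T⟩⟩
  · exact ⟨0, Subsingleton.elim _ _⟩
  · refine ⟨c.act l (c.i z) T T, ?_⟩
    ext S' S
    have h1 := c.repr_mul_C l z S T S' T
    rw [hz, repr_C_mul, if_pos rfl] at h1
    rw [← h1, Matrix.smul_apply, Matrix.one_apply]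
    by_cases h : S = S'
    · simp [h]
    · simp [h, Ne.symm h]

theorem cellChar_central_mul (l : Λ) {z : A} (hz : ∀ a, z * a = a * z) :
    ∃ s : R, ∀ a, c.cellChar l (z * a) = s * c.cellChar l a := by
  obtain ⟨s, hs⟩ := c.act_central l hz
  exact ⟨s, fun a => by simp [cellChar, act_mul, hs]⟩

/-! ### The elements `x_l` and their span -/

section Span

variable (τ : A →ₗ[R] R) (hτ : IsSymmetrizingTrace τ)

theorem trace_D_mul (p : Σ l : Λ, M l × M l) (a : A) :
    τ (c.D τ hτ p * a) = c.C.repr a p :=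
  trace_dualBasis_mul_eq_repr c.C τ hτ p a

/-- `x_l` represents the cell character with respect to `τ`. -/
theorem trace_x_mul (l : Λ) (T : M l) (y : A) : τ (c.x τ hτ l T * y) = c.cellChar l y := by
  classical
  rw [x, Finset.sum_mul, map_sum, cellChar, Matrix.trace]
  refine Finset.sum_congr rfl fun S _ => ?_
  rw [mul_assoc, hτ.mul_comm, mul_assoc, trace_D_mul, repr_mul_C, if_pos rfl, Matrix.diag_apply]

theorem x_eq (l : Λ) (T T' : M l) : c.x τ hτ l T = c.x τ hτ l T' :=
  hτ.ext fun y => by rw [trace_x_mul, trace_x_mul]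

theorem x_central (l : Λ) (T : M l) (a : A) : c.x τ hτ l T * a = a * c.x τ hτ l T :=
  hτ.ext fun y => by
    rw [mul_assoc, trace_x_mul, cellChar_mul_comm, mul_assoc, hτ.mul_comm, mul_assoc, trace_x_mul]

theorem x_mem_L (l : Λ) (T : M l) : c.x τ hτ l T ∈ c.L τ hτ :=
  Submodule.subset_span ⟨l, T, rfl⟩

theorem central_mul_x (l : Λ) (T : M l) {z : A} (hz : ∀ a, z * a = a * z) :
    ∃ s : R, z * c.x τ hτ l T = s • c.x τ hτ l T := by
  obtain ⟨s, hs⟩ := c.cellChar_central_mul l hz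
  refine ⟨s, hτ.ext fun y => ?_⟩
  rw [hz, mul_assoc, trace_x_mul, hs, smul_mul_assoc, map_smul, trace_x_mul, smul_eq_mul]

theorem L_le_center : c.L τ hτ ≤ Subalgebra.toSubmodule (Subalgebra.center R A) := by
  refine Submodule.span_le.2 ?_
  rintro _ ⟨l, T, rfl⟩
  rw [SetLike.mem_coe, Subalgebra.mem_toSubmodule, Subalgebra.mem_center_iff]
  exact fun b => (c.x_central τ hτ l T b).symm

theorem central_mul_mem_L {z y : A} (hz : ∀ a, z * a = a * z) (hy : y ∈ c.L τ hτ) :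
    z * y ∈ c.L τ hτ := by
  induction hy using Submodule.span_induction with
  | mem x hx =>
    obtain ⟨l, T, rfl⟩ := hx
    obtain ⟨s, hs⟩ := c.central_mul_x τ hτ l T hz
    rw [hs]
    exact Submodule.smul_mem _ _ (c.x_mem_L τ hτ l T)
  | zero => simp
  | add x y _ _ hx hy => rw [mul_add]; exact add_mem hx hy
  | smul r x _ hx => rw [mul_smul_comm]; exact Submodule.smul_mem _ _ hx

theorem exists_ideal_eq_L : ∃ I : Ideal (Subalgebra.center R A),
    (c.L τ hτ : Set A) = (fun z : Subalgebra.center R A => (z : A)) '' (I : Set _) := by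
  refine ⟨{ carrier := {z | (z : A) ∈ c.L τ hτ}
            add_mem' := fun ha hb => (c.L τ hτ).add_mem ha hb
            zero_mem' := zero_mem (c.L τ hτ)
            smul_mem' := fun z y hy => c.central_mul_mem_L τ hτ
              (fun a => (Subalgebra.mem_center_iff.1 z.2 a).symm) hy }, ?_⟩
  ext y
  constructor
  · exact fun hy => ⟨⟨y, c.L_le_center τ hτ hy⟩, hy, rfl⟩
  · rintro ⟨z, hz, rfl⟩
    exact hz

/-- The element of the Higman ideal formed with `a` is `∑_l χ_l(i a) x_l`, where the sum is over the
`l` with `M l` nonempty. -/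
theorem higman_subset_L : c.higman τ hτ ⊆ (c.L τ hτ : Set A) := by
  classical
  rintro _ ⟨a, rfl⟩
  have key : ∑ p : (Σ l : Λ, M l × M l), c.C p * a * c.D τ hτ p =
      ∑ l : Λ, if h : Nonempty (M l) then c.cellChar l (c.i a) • c.x τ hτ l h.some else 0 := by
    refine hτ.ext fun y => ?_
    rw [Finset.sum_mul, Finset.sum_mul, map_sum, map_sum, Fintype.sum_sigma]
    refine Finset.sum_congr rfl fun l _ => ?_
    have hp : ∀ p : M l × M l, τ (c.C ⟨l, p⟩ * a * c.D τ hτ ⟨l, p⟩ * y) =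
        c.act l y p.1 p.1 * c.act l (c.i a) p.2 p.2 := by
      rintro ⟨S, T⟩
      rw [mul_assoc, hτ.mul_comm, mul_assoc, trace_D_mul, ← mul_assoc, repr_mul_C_mul]
    simp only [hp]
    split_ifs with h
    · rw [smul_mul_assoc, map_smul, trace_x_mul, Fintype.sum_prod_type, smul_eq_mul, mul_comm,
        cellChar, cellChar, Matrix.trace, Matrix.trace, Finset.sum_mul_sum]
      rfl
    · rw [not_nonempty_iff] at h
      simp
  rw [key]
  refine sum_mem fun l _ => ?_
  split_ifs with h
  · exact Submodule.smul_mem _ _ (c.x_mem_L τ hτ l _)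
  · exact zero_mem _

theorem L_le_L (τ' : A →ₗ[R] R) (hτ' : IsSymmetrizingTrace τ') : c.L τ' hτ' ≤ c.L τ hτ := by
  obtain ⟨u, hu, h⟩ := hτ'.exists_central hτ
  refine Submodule.span_le.2 ?_
  rintro _ ⟨l, T, rfl⟩
  have hx : c.x τ' hτ' l T = u * c.x τ hτ l T := hτ'.ext fun y => by
    rw [mul_assoc, ← h, trace_x_mul, trace_x_mul]
  rw [hx]
  exact c.central_mul_mem_L τ hτ hu (c.x_mem_L τ hτ l T)

end Span

/-! ### The bilinear forms on the cell modules -/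

/-- Modulo `A(< l)`, the product `C_{S,T} a C_{U,V}` is a multiple of `C_{S,V}`. -/
theorem C_mul_mul_C_sub_mem (l : Λ) (a : A) (S T U V : M l) :
    c.C ⟨l, S, T⟩ * a * c.C ⟨l, U, V⟩ - c.act l (c.C ⟨l, S, T⟩ * a) S U • c.C ⟨l, S, V⟩ ∈
      lowerSpan c.C l := by
  classical
  have h := c.mul_C_sub_mem l (c.C ⟨l, S, T⟩ * a) U V
  rwa [Finset.sum_eq_single S] at h
  · intro S' _ hS'
    have h1 := c.repr_mul_C l (c.C ⟨l, S, T⟩ * a) U V S' V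
    rw [mul_assoc, repr_C_mul, if_neg hS'.symm, if_pos rfl] at h1
    rw [← h1, zero_smul]
  · simp

/-- The bilinear form of Graham and Lehrer on the cell module of `l`, in the basis `M l`. -/
noncomputable def gram (l : Λ) (T U : M l) : R :=
  c.act l (c.C ⟨l, T, T⟩) T U

theorem act_C (l : Λ) (S T U : M l) : c.act l (c.C ⟨l, S, T⟩) S U = c.gram l T U := by
  classical
  -- The coefficient of `C_{S,V}` in `C_{S,T} C_{U,V}` depends neither on `S` nor on `V`.
  have h : ∀ S, c.act l (c.C ⟨l, S, T⟩) S U = c.act l (c.C ⟨l, U, U⟩) U T := fun S => by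
    have h1 := c.repr_mul_C l (c.C ⟨l, S, T⟩) U U S U
    rw [repr_C_mul, if_pos rfl, if_pos rfl, c.i_C] at h1
    exact h1.symm
  rw [gram, h S, h T]

theorem C_mul_C_sub_mem (l : Λ) (S T U V : M l) :
    c.C ⟨l, S, T⟩ * c.C ⟨l, U, V⟩ - c.gram l T U • c.C ⟨l, S, V⟩ ∈ lowerSpan c.C l := by
  have h := c.C_mul_mul_C_sub_mem l 1 S T U V
  rwa [mul_one, act_C] at h

theorem cellChar_C (l : Λ) (U T : M l) : c.cellChar l (c.C ⟨l, U, T⟩) = c.gram l T U := by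
  classical
  rw [cellChar, Matrix.trace, Finset.sum_eq_single U]
  · exact c.act_C l U T U
  · intro S _ hS
    have h1 := c.repr_mul_C l (c.C ⟨l, U, T⟩) S S S S
    rwa [repr_C_mul, if_neg hS.symm, if_pos rfl, eq_comm] at h1
  · simp

theorem cellChar_C_eq_zero {l m : Λ} (h : ¬ m ≤ l) (U T : M l) :
    c.cellChar m (c.C ⟨l, U, T⟩) = 0 := by
  classical
  refine Finset.sum_eq_zero fun S _ => ?_
  have h1 := c.repr_mul_C m (c.C ⟨l, U, T⟩) S S S S
  rw [if_pos rfl] at h1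
  rw [Matrix.diag_apply, ← h1, ← sub_add_cancel (c.C ⟨l, U, T⟩ * c.C ⟨m, S, S⟩)
    (∑ T' : M l, c.act l (c.i (c.C ⟨m, S, S⟩)) T' T • c.C ⟨l, U, T'⟩), map_add,
    Finsupp.add_apply, c.repr_eq_zero_of_mem_lowerSpan (c.C_mul_sub_mem l _ U T) _
      (fun h' => h h'.le), zero_add, map_sum, Finsupp.finsetSum_apply]
  refine Finset.sum_eq_zero fun T' _ => ?_
  rw [map_smul, Finsupp.smul_apply, c.C.repr_self, Finsupp.single_apply, if_neg, smul_zero]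
  intro h'
  exact h (congrArg Sigma.fst h').ge

/-- The labels `l` whose bilinear form is nonzero. -/
def NonzeroForm (l : Λ) : Prop :=
  ∃ T U : M l, c.gram l T U ≠ 0

theorem linearIndependent_x [IsDomain R] (τ : A →ₗ[R] R) (hτ : IsSymmetrizingTrace τ)
    (T : ∀ l : {l // c.NonzeroForm l}, M l.1) :
    LinearIndependent R fun l : {l // c.NonzeroForm l} => c.x τ hτ l.1 (T l) := by
  classical
  rw [Fintype.linearIndependent_iff]
  intro g hg l
  -- Once the coefficients below `l` vanish, pairing the relation with a `C^l_{U,V}` such that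
  -- `φ_l(V,U) ≠ 0` leaves the `l`-th term only.
  induction l using WellFoundedLT.induction with
  | ind l ih =>
    obtain ⟨V, U, hVU⟩ := l.2
    have h := congrArg (fun y => τ (y * c.C ⟨l.1, U, V⟩)) hg
    simp only [Finset.sum_mul, map_sum, smul_mul_assoc, map_smul, trace_x_mul, zero_mul,
      map_zero, smul_eq_mul] at h
    rw [Finset.sum_eq_single l, cellChar_C] at h
    · exact (mul_eq_zero.1 h).resolve_right hVU
    · intro m _ hm
      by_cases hml : m.1 ≤ l.1
      · rw [ih m (lt_of_le_of_ne hml hm), zero_mul]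
      · rw [c.cellChar_C_eq_zero hml, mul_zero]
    · simp

theorem card_nonzeroForm_le_finrank [IsDomain R] (τ : A →ₗ[R] R) (hτ : IsSymmetrizingTrace τ) :
    Nat.card {l // c.NonzeroForm l} ≤ Module.finrank R (c.L τ hτ) := by
  classical
  have hfin : Module.Finite R (c.L τ hτ) := by
    refine Module.Finite.span_of_finite R
      ((Set.finite_range fun p : Σ l, M l => c.x τ hτ p.1 p.2).subset ?_)
    rintro _ ⟨l, T, rfl⟩
    exact ⟨⟨l, T⟩, rfl⟩
  have hT : ∀ l : {l // c.NonzeroForm l}, Nonempty (M l.1) := fun l => ⟨l.2.choose⟩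
  have h := c.linearIndependent_x τ hτ fun l => (hT l).some
  have h' : LinearIndependent R fun l : {l // c.NonzeroForm l} =>
      (⟨c.x τ hτ l.1 (hT l).some, c.x_mem_L τ hτ _ _⟩ : c.L τ hτ) :=
    LinearIndependent.of_comp (c.L τ hτ).subtype h
  rw [Nat.card_eq_fintype_card]
  exact h'.fintype_card_le_finrank

/-! ### Simple modules -/

section Simple

variable {V : Type*} [AddCommGroup V] [Module A V]

/-- `V` lives in the cell of `l`: the elements `C^l_{S,T}` do not all annihilate `V`, but those for
smaller labels do. -/
def Supports (l : Λ) (V : Type*) [AddCommGroup V] [Module A V] : Prop :=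
  (∃ (S T : M l) (v : V), c.C ⟨l, S, T⟩ • v ≠ 0) ∧
    ∀ m < l, ∀ (S T : M m) (v : V), c.C ⟨m, S, T⟩ • v = 0

theorem exists_supports [Nontrivial V] : ∃ l, c.Supports l V := by
  have hne : {l : Λ | ∃ (S T : M l) (v : V), c.C ⟨l, S, T⟩ • v ≠ 0}.Nonempty := by
    by_contra hcon
    rw [Set.not_nonempty_iff_eq_empty, Set.eq_empty_iff_forall_notMem] at hcon
    obtain ⟨v, hv⟩ := exists_ne (0 : V)
    apply hv
    rw [← one_smul A v, ← c.C.sum_repr 1, Finset.sum_smul]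
    refine Finset.sum_eq_zero fun p _ => ?_
    obtain ⟨l, S, T⟩ := p
    have : c.C ⟨l, S, T⟩ • v = 0 := by
      by_contra h
      exact hcon l ⟨S, T, v, h⟩
    rw [Algebra.smul_def, mul_smul, this, smul_zero]
  obtain ⟨l, hl, hmin⟩ := wellFounded_lt.has_min _ hne
  refine ⟨l, hl, fun m hm S T v => ?_⟩
  by_contra h
  exact hmin m ⟨S, T, v, h⟩ hm

variable {c} {l : Λ}

theorem Supports.smul_eq_zero (hV : c.Supports l V) {z : A} (hz : z ∈ lowerSpan c.C l) (v : V) :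
    z • v = 0 := by
  induction hz using Submodule.span_induction with
  | mem x hx =>
    obtain ⟨m, S, T, hm, rfl⟩ := hx
    exact hV.2 m hm S T v
  | zero => simp
  | add x y _ _ hx hy => rw [add_smul, hx, hy, add_zero]
  | smul r x _ hx => rw [Algebra.smul_def, mul_smul, hx, smul_zero]

theorem Supports.smul_eq (hV : c.Supports l V) {y z : A} (h : y - z ∈ lowerSpan c.C l) (v : V) :
    y • v = z • v := by
  rw [← sub_eq_zero, ← sub_smul, hV.smul_eq_zero h]

/-- For `w = C_{S,T} v ≠ 0` in a simple module, the annihilator of `w` is described by structure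
constants of `A` alone. -/
theorem Supports.smul_C_smul_eq_zero_iff [IsSimpleModule A V] (hR : IsField R)
    (hV : c.Supports l V) {S T : M l} {v : V} (hv : c.C ⟨l, S, T⟩ • v ≠ 0) (a : A) :
    a • c.C ⟨l, S, T⟩ • v = 0 ↔ ∀ b : A, c.act l (c.C ⟨l, S, T⟩ * (b * a)) S S = 0 := by
  have key : ∀ b : A, c.C ⟨l, S, T⟩ • b • a • c.C ⟨l, S, T⟩ • v =
      algebraMap R A (c.act l (c.C ⟨l, S, T⟩ * (b * a)) S S) • c.C ⟨l, S, T⟩ • v := fun b => by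
    have h := hV.smul_eq (c.C_mul_mul_C_sub_mem l (b * a) S T S T) v
    rwa [Algebra.smul_def, mul_smul, mul_smul, mul_smul, mul_smul] at h
  constructor
  · intro h b
    by_contra hk
    obtain ⟨k, hk⟩ := hR.mul_inv_cancel hk
    have h1 := key b
    rw [h, smul_zero, smul_zero] at h1
    apply hv
    rw [← one_smul A (c.C ⟨l, S, T⟩ • v), ← map_one (algebraMap R A), ← hk, _root_.mul_comm,
      map_mul, mul_smul, ← h1, smul_zero]
  · intro h
    by_contra hne
    obtain ⟨b, hb⟩ := IsSimpleModule.toSpanSingleton_surjective A hne v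
    rw [LinearMap.toSpanSingleton_apply] at hb
    have h1 := key b
    rw [hb, h b, map_zero, zero_smul] at h1
    exact hv h1

theorem Supports.nonzeroForm [IsSimpleModule A V] (hV : c.Supports l V) : c.NonzeroForm l := by
  by_contra hcon
  simp only [NonzeroForm, not_exists, not_not] at hcon
  obtain ⟨S, T, v, hv⟩ := hV.1
  obtain ⟨a, ha⟩ := IsSimpleModule.toSpanSingleton_surjective A hv v
  rw [LinearMap.toSpanSingleton_apply] at ha
  apply hv
  conv_lhs => rw [← ha]
  -- `a C_{S,T}` is a combination of the `C_{S',T}`, and each `C_{S,T} C_{S',T}` acts as zero.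
  rw [← mul_smul a, hV.smul_eq (c.mul_C_sub_mem l a S T), Finset.sum_smul, Finset.smul_sum]
  refine Finset.sum_eq_zero fun S' _ => ?_
  rw [← mul_smul, mul_smul_comm, Algebra.smul_def, mul_smul,
    hV.smul_eq (c.C_mul_C_sub_mem l S T S' T), hcon, zero_smul, zero_smul, smul_zero]

/-- If `φ_l(T,U) ≠ 0`, then `C_{U,T}` acts as nonzero, because
`C_{S,T} C_{U,T} C_{U,Q} ≡ φ_l(T,U)² C_{S,Q}`. -/
theorem Supports.exists_C_smul_ne_zero (hR : IsField R) (hV : c.Supports l V) {T U : M l}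
    (h : c.gram l T U ≠ 0) : ∃ v : V, c.C ⟨l, U, T⟩ • v ≠ 0 := by
  by_contra! hcon
  obtain ⟨k, hk⟩ := hR.mul_inv_cancel h
  obtain ⟨S, Q, v, hv⟩ := hV.1
  have step : ∀ (P : M l) (w : V), c.C ⟨l, S, T⟩ • c.C ⟨l, U, P⟩ • w = 0 →
      c.C ⟨l, S, P⟩ • w = 0 := fun P w hw => by
    rw [← mul_smul, hV.smul_eq (c.C_mul_C_sub_mem l S T U P), Algebra.smul_def, mul_smul] at hw
    rw [← one_smul A (c.C ⟨l, S, P⟩ • w), ← map_one (algebraMap R A), ← hk, _root_.mul_comm,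
      map_mul, mul_smul, hw, smul_zero]
  refine hv (step Q v (step T _ ?_))
  rw [hcon, smul_zero]

theorem Supports.nonempty_linearEquiv {W : Type*} [AddCommGroup W] [Module A W]
    [IsSimpleModule A V] [IsSimpleModule A W] (hR : IsField R)
    (hV : c.Supports l V) (hW : c.Supports l W) : Nonempty (V ≃ₗ[A] W) := by
  obtain ⟨T, U, h⟩ := hV.nonzeroForm
  obtain ⟨v, hv⟩ := hV.exists_C_smul_ne_zero hR h
  obtain ⟨w, hw⟩ := hW.exists_C_smul_ne_zero hR h
  have hker : LinearMap.ker (LinearMap.toSpanSingleton A V (c.C ⟨l, U, T⟩ • v)) =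
      LinearMap.ker (LinearMap.toSpanSingleton A W (c.C ⟨l, U, T⟩ • w)) := by
    ext a
    rw [LinearMap.mem_ker, LinearMap.mem_ker, LinearMap.toSpanSingleton_apply,
      LinearMap.toSpanSingleton_apply, hV.smul_C_smul_eq_zero_iff hR hv,
      hW.smul_C_smul_eq_zero_iff hR hw]
  exact ⟨(LinearMap.quotKerEquivOfSurjective _
      (IsSimpleModule.toSpanSingleton_surjective A hv)).symm ≪≫ₗ
    Submodule.quotEquivOfEq _ _ hker ≪≫ₗ
    LinearMap.quotKerEquivOfSurjective _ (IsSimpleModule.toSpanSingleton_surjective A hw)⟩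

end Simple

theorem exists_injective_simpleModuleClasses {A : Type v} [Ring A] [Algebra R A]
    (c : CellDatum R A Λ M) (hR : IsField R) :
    ∃ f : SimpleModuleClasses.{v, w} A → {l // c.NonzeroForm l}, Function.Injective f := by
  have h : ∀ q : SimpleModuleClasses.{v, w} A, ∃ l, c.Supports l q.out.1 := fun q =>
    haveI := q.out.2
    haveI := IsSimpleModule.nontrivial A q.out.1
    c.exists_supports
  choose f hf using h
  refine ⟨fun q => ⟨f q, haveI := q.out.2; (hf q).nonzeroForm⟩, fun q q' hqq' => ?_⟩
  have := q.out.2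
  have := q'.out.2
  have hq' := hf q'
  rw [← Subtype.mk.inj hqq'] at hq'
  rw [← Quotient.out_eq q, ← Quotient.out_eq q']
  exact Quotient.sound ((hf q).nonempty_linearEquiv hR hq')

end CellDatum

end SymmCellular

theorem theorem3p2 {R : Type u} {A : Type v} [CommRing R] [Ring A] [Algebra R A]
    {Λ : Type*} [PartialOrder Λ] [Fintype Λ] {M : Λ → Type*} [∀ l, Fintype (M l)]
    (c : SymmCellular.CellDatum R A Λ M)
    (τ : A →ₗ[R] R) (hτ : SymmCellular.IsSymmetrizingTrace τ) :
    (∀ (l : Λ) (T T' : M l), c.x τ hτ l T = c.x τ hτ l T') ∧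
    (∃ I : Ideal (Subalgebra.center R A),
      (c.L τ hτ : Set A) = (fun z : Subalgebra.center R A => (z : A)) '' (I : Set _)) ∧
    c.higman τ hτ ⊆ (c.L τ hτ : Set A) ∧
    (∀ (τ' : A →ₗ[R] R) (hτ' : SymmCellular.IsSymmetrizingTrace τ'),
      c.L τ' hτ' = c.L τ hτ) ∧
    (IsField R →
      Finite (SymmCellular.SimpleModuleClasses.{v, w} A) ∧
      Nat.card (SymmCellular.SimpleModuleClasses.{v, w} A) ≤ Module.finrank R (c.L τ hτ)) := by
  refine ⟨c.x_eq τ hτ, c.exists_ideal_eq_L τ hτ, c.higman_subset_L τ hτ,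
    fun τ' hτ' => le_antisymm (c.L_le_L τ hτ τ' hτ') (c.L_le_L τ' hτ' τ hτ), fun hR => ?_⟩
  have := hR.isDomain
  obtain ⟨f, hf⟩ := c.exists_injective_simpleModuleClasses.{v, w} hR
  exact ⟨Finite.of_injective f hf,
    (Nat.card_le_card_of_injective f hf).trans (c.card_nonzeroForm_le_finrank τ hτ)⟩
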